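/- Let $\mathbb N=\{0,1,2,\dots\}$, let $[\mathbb N]^\infty$ be the family of infinite subsets of $\mathbb N$ and $\mathrm{Fin}$ the family of finite subsets of $\mathbb N$. Identify each $a\in[\mathbb N]^\infty$ with its increasing enumeration $a(0)<a(1)<\cdots$, and identify the family of all subsets of $\mathbb N$ with the Cantor space $\{0,1\}^{\mathbb N}$ via characteristic functions. A family $F\subseteq[\mathbb N]^\infty$ is centered if all intersections of finitely many of its members are infinite; a pseudointersection of $F$ is an infinite set $a$ such that $a\setminus b$ is finite for all $b\in F$. Let $\mathfrak p$ be the minimal cardinality of a centered family $F\subseteq[\mathbb N]^\infty$ that has no pseudointersection. A set $X\subseteq[\mathbb N]^\infty$ with $|X|\ge\mathfrak p$ is a $\mathfrak p$-generalized tower if for each $a\in[\mathbb N]^\infty$ there are $b\in[\mathbb N]^\infty$ and $S\subseteq X$ with $|S|<\mathfrak p$ such that $$x\cap\bigcup_{n\in b}[a(n),a(n+1))$$ is finite for all $x\in X\setminus S$. A $\mathfrak p$-generalized tower set is a set $X\cup\mathrm{Fin}$, where $X$ is a $\mathfrak p$-generalized tower, with the subspace topology of the Cantor space. A set of reals is a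 topological space homeomorphic to a subset of the real line. A cover of a space is a family of proper subsets of the space whose union is the entire space; it is open if its members are open. An $\omega$-cover is an open cover such that each finite subset of the space is contained in a member of the cover; $\Omega$ is the class of $\omega$-covers. A $\gamma$-cover is an infinite cover such that each point of the space belongs to all but finitely many members of the cover. A space satisfies $\binom{\Omega}{\Gamma}$ (the Gerlits--Nagy property $\gamma$) if each $\omega$-cover of the space contains a $\gamma$-cover of the space. A space satisfies $\mathsf S_1(\Omega,\Omega)$ if for each sequence $\mathcal U_0,\mathcal U_1,\dots$ of $\omega$-covers of the space there are $U_n\in\mathcal U_n$ such that $\{U_n:n\in\mathbb N\}$ is an $\omega$-cover of the space. **Corollary.** Let $X\cup\mathrm{Fin}$ be a $\mathfrak p$-generalized tower set and let $Y$ be a set of reals satisfying $\binom{\Omega}{\Gamma}$. Then the product space $(X\cup\mathrm{Fin})\times Y$ satisfies $\mathsf S_1(\Omega,\Omega)$. -/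

import Mathlib

/-! Covers and selection principles. -/

/-- A cover of a space: a family of proper subsets whose union is the whole space. -/
def IsProperCover {Z : Type*} (U : Set (Set Z)) : Prop :=
  (∀ u ∈ U, u ≠ Set.univ) ∧ ⋃₀ U = Set.univ

/-- An open cover: a cover whose members are open. -/
def IsOpenProperCover {Z : Type*} [TopologicalSpace Z] (U : Set (Set Z)) : Prop :=
  IsProperCover U ∧ ∀ u ∈ U, IsOpen u

/-- The class `Ω(Z)` of `ω`-covers: open covers such that every finite subset of the space is
contained in a member of the cover. -/
def omegaCovers (Z : Type*) [TopologicalSpace Z] : Set (Set (Set Z)) :=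
  {U | IsOpenProperCover U ∧ ∀ F : Set Z, F.Finite → ∃ u ∈ U, F ⊆ u}

/-- A `γ`-cover: an infinite cover such that every point belongs to all but finitely many
members of the cover. -/
def IsGammaCover {Z : Type*} (U : Set (Set Z)) : Prop :=
  IsProperCover U ∧ U.Infinite ∧ ∀ z : Z, {u ∈ U | z ∉ u}.Finite

/-- The Gerlits–Nagy property `γ`: every `ω`-cover contains a `γ`-cover. -/
def SatisfiesGamma (Z : Type*) [TopologicalSpace Z] : Prop :=
  ∀ U ∈ omegaCovers Z, ∃ V ⊆ U, IsGammaCover V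

/-- The selection principle `S₁(A, B)`, for families `A`, `B` of covers of a space `Z`. -/
def SelOne {Z : Type*} (A B : Set (Set (Set Z))) : Prop :=
  ∀ U : ℕ → Set (Set Z), (∀ n, U n ∈ A) →
    ∃ V : ℕ → Set Z, (∀ n, V n ∈ U n) ∧ Set.range V ∈ B

/-- A set of reals: a space homeomorphic to a subset of the real line. -/
def IsSetOfReals (Z : Type*) [TopologicalSpace Z] : Prop :=
  ∃ s : Set ℝ, Nonempty (Z ≃ₜ s)

/-! The pseudointersection number. -/

/-- A family of sets is centered if all intersections of finite subfamilies are infinite. -/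
def IsCenteredFamily (F : Set (Set ℕ)) : Prop :=
  ∀ G ⊆ F, G.Finite → (⋂₀ G).Infinite

/-- `a` is a pseudointersection of `F`: an infinite set almost contained in every member. -/
def IsPseudointersection (a : Set ℕ) (F : Set (Set ℕ)) : Prop :=
  a.Infinite ∧ ∀ b ∈ F, (a \ b).Finite

/-- The cardinal `𝔭`: the minimal cardinality of a centered family of infinite subsets of `ℕ`
with no pseudointersection. -/
noncomputable def pseudointersectionNumber : Cardinal.{0} :=
  sInf {κ | ∃ F : Set (Set ℕ), (∀ b ∈ F, b.Infinite) ∧ IsCenteredFamily F ∧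
    (¬ ∃ a, IsPseudointersection a F) ∧ Cardinal.mk F = κ}

/-! Generalized towers. -/

/-- The interval `[a(n), a(n+1))`, where an infinite set `a` is identified with its increasing
enumeration `a(0) < a(1) < ⋯`. -/
noncomputable def enumInterval (a : Set ℕ) (n : ℕ) : Set ℕ :=
  Set.Ico (Nat.nth (· ∈ a) n) (Nat.nth (· ∈ a) (n + 1))

/-- A family `X` of infinite subsets of `ℕ` is a `κ`-generalized tower if `|X| ≥ κ` and for every
infinite `a` there are an infinite `b` and `S ⊆ X` with `|S| < κ` such that
`x ∩ ⋃_{n ∈ b} [a(n), a(n+1))` is finite for all `x ∈ X \ S`. -/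
def IsGeneralizedTower (κ : Cardinal.{0}) (X : Set (Set ℕ)) : Prop :=
  (∀ x ∈ X, x.Infinite) ∧ κ ≤ Cardinal.mk X ∧
    ∀ a : Set ℕ, a.Infinite →
      ∃ b : Set ℕ, b.Infinite ∧ ∃ S ⊆ X, Cardinal.mk S < κ ∧
        ∀ x ∈ X \ S, (x ∩ ⋃ n ∈ b, enumInterval a n).Finite

/-- The set `X ∪ Fin`, where `Fin` is the family of finite subsets of `ℕ`, as a subset of the Cantor
space `ℕ → Bool`: subsets of `ℕ` are identified with their characteristic functions. For a
`κ`-generalized tower `X` this is the corresponding `κ`-generalized tower set, a space with the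
subspace topology. -/
def towerSet (X : Set (Set ℕ)) : Set (ℕ → Bool) :=
  {x | {n | x n = true} ∈ X ∪ {s : Set ℕ | s.Finite}}

/-! Split the covers into countably many sequences, one per stage. Stage `k` starts from a part `T
k` of the tower with fewer than `𝔭` elements and captures every finite set with no point over `T (k
+ 1) \ T k`. These differences are disjoint, so each finite set is captured at some stage.

One stage (`IsGeneralizedTower.exists_selection`), for `S` of size below `𝔭`: open sets are coded by
integers. For each finite `G ⊆ S`, property γ of `Y` yields codes `f G m` whose sets eventually
contain `(x, y)`, for every `y`, whenever `x ⊆ [0, m)` or `x ∈ G`. There are fewer than `𝔭` such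
`G`, so a single `g` agrees with each `f G` in almost every interval of a partition. After merging
intervals, the tower property makes every `x` outside a small `S'` vanish on infinitely many common
intervals; there `x` is indistinguishable from a finite truncation, which `g` handles. Points of `S`
are handled through `G`, so only `S' \ S` is lost. -/

open Set Filter Cardinal

/-! ### Selections from property γ -/

/-- In a T₁ space satisfying the Gerlits–Nagy property `γ`, one can select from a sequence of open
`ω`-covering families (possibly containing the whole space) sets forming a sequence that contains
each point from some index on. -/
theorem SatisfiesGamma.exists_selection {Y : Type*} [TopologicalSpace Y] [T1Space Y]
    (hY : SatisfiesGamma Y) (W : ℕ → Set (Set Y)) (hopen : ∀ n, ∀ w ∈ W n, IsOpen w)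
    (hcov : ∀ n, ∀ F : Set Y, F.Finite → ∃ w ∈ W n, F ⊆ w) :
    ∃ w : ℕ → Set Y, (∀ n, w n ∈ W n) ∧ ∀ y, ∀ᶠ n in atTop, y ∈ w n := by
  rcases finite_or_infinite Y with hfin | hinf
  · choose w hw hsub using fun n => hcov n univ (toFinite _)
    exact ⟨w, hw, fun y => Eventually.of_forall fun n => hsub n (mem_univ y)⟩
  let p : ℕ ↪ Y := Infinite.natEmbedding Y
  -- Deleting `p m` keeps the sets proper and tags them: a γ-cover has only finitely many members
  -- omitting a given `p m`, so its tags are unbounded.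
  let U : Set (Set Y) :=
    {v | ∃ m : ℕ, ∃ w : ℕ → Set Y, (∀ i, w i ∈ W i) ∧ v = (⋂ i ∈ Iic m, w i) \ {p m}}
  have hUcov : ∀ F : Set Y, F.Finite → ∃ u ∈ U, F ⊆ u := by
    intro F hF
    choose w hw hsub using fun n => hcov n F hF
    obtain ⟨m, hm⟩ : ∃ m, p m ∉ F := by
      by_contra! h
      exact (infinite_range_of_injective p.injective) (hF.subset (range_subset_iff.2 h))
    refine ⟨_, ⟨m, w, hw, rfl⟩, fun y hy => ⟨mem_iInter₂.2 fun i _ => hsub i hy, ?_⟩⟩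
    rintro rfl
    exact hm hy
  have hU : U ∈ omegaCovers Y := by
    refine ⟨⟨⟨?_, ?_⟩, ?_⟩, hUcov⟩
    · rintro u ⟨m, w, -, rfl⟩ h
      have : p m ∈ (⋂ i ∈ Iic m, w i) \ {p m} := h ▸ mem_univ _
      exact this.2 rfl
    · refine eq_univ_of_forall fun y => ?_
      obtain ⟨u, hu, hy⟩ := hUcov {y} (finite_singleton y)
      exact ⟨u, hu, hy rfl⟩
    · rintro u ⟨m, w, hw, rfl⟩
      exact ((finite_Iic m).isOpen_biInter fun i _ => hopen i _ (hw i)).sdiff isClosed_singleton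
  obtain ⟨V, hVU, -, hVinf, hV⟩ := hY U hU
  choose! μ w hw hμ using fun v (hv : v ∈ V) => hVU hv
  have hlarge : ∀ n, ∃ v ∈ V, n ≤ μ v := by
    intro n
    by_contra! h
    refine hVinf (((finite_Iio n).biUnion fun m _ => hV (p m)).subset fun v hv => ?_)
    refine mem_biUnion (h v hv) ⟨hv, fun hp => ?_⟩
    exact (hμ v hv ▸ hp : p (μ v) ∈ (⋂ i ∈ Iic (μ v), w v i) \ {p (μ v)}).2 rfl
  choose v hvV hv using hlarge
  -- Since `n ≤ μ (v n)`, the set `w (v n) n` is one of the factors intersected in `v n`.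
  refine ⟨fun n => w (v n) n, fun n => hw _ (hvV n) n, fun y => ?_⟩
  obtain ⟨N, hN⟩ := ((hV y).image μ).bddAbove
  filter_upwards [eventually_gt_atTop N] with n hn
  have hy : y ∈ v n := by
    by_contra hy
    have := hN (mem_image_of_mem μ (show v n ∈ {u ∈ V | y ∉ u} from ⟨hvV n, hy⟩))
    have := hv n
    omega
  rw [hμ _ (hvV n)] at hy
  exact mem_iInter₂.1 hy.1 n (hv n)

/-! ### Families of fewer than `𝔭` sets or functions -/

/-- A countable centered family has a pseudointersection. -/
theorem IsCenteredFamily.exists_isPseudointersection {F : Set (Set ℕ)} (hF : IsCenteredFamily F)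
    (hc : F.Countable) : ∃ a, IsPseudointersection a F := by
  rcases F.eq_empty_or_nonempty with rfl | hne
  · exact ⟨univ, infinite_univ, by simp⟩
  obtain ⟨b, rfl⟩ := hc.exists_eq_range hne
  have h : ∀ n, ∃ m, n ≤ m ∧ ∀ i ≤ n, m ∈ b i := by
    intro n
    obtain ⟨m, hm, hnm⟩ := (hF (b '' Iic n) (image_subset_range _ _)
      ((finite_Iic n).image b)).exists_gt n
    exact ⟨m, hnm.le, fun i hi => hm _ (mem_image_of_mem b hi)⟩
  choose m hm hmb using h
  refine ⟨range m, ?_, ?_⟩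
  · refine infinite_of_not_bddAbove ?_
    rintro ⟨N, hN⟩
    have h1 := hN (mem_range_self (N + 1))
    have h2 := hm (N + 1)
    omega
  · rintro _ ⟨i, rfl⟩
    refine ((finite_Iio i).image m).subset ?_
    rintro _ ⟨⟨n, rfl⟩, hn⟩
    refine mem_image_of_mem m ?_
    by_contra h
    exact hn (hmb n i (not_lt.1 h))

/-- The hypothesis excludes the junk value `sInf ∅ = 0`; the infimum is then attained by a family
that cannot be countable. -/
theorem aleph0_lt_pseudointersectionNumber (h : pseudointersectionNumber ≠ 0) :
    ℵ₀ < pseudointersectionNumber := by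
  have hne : {κ | ∃ F : Set (Set ℕ), (∀ b ∈ F, b.Infinite) ∧ IsCenteredFamily F ∧
      (¬ ∃ a, IsPseudointersection a F) ∧ Cardinal.mk F = κ}.Nonempty := by
    by_contra hne
    rw [not_nonempty_iff_eq_empty] at hne
    exact h (by rw [pseudointersectionNumber, hne, Cardinal.sInf_empty])
  obtain ⟨F, -, hF, hno, hcard⟩ := csInf_mem hne
  change #F = pseudointersectionNumber at hcard
  rw [← hcard]
  by_contra! hle
  exact hno (hF.exists_isPseudointersection (le_aleph0_iff_set_countable.1 hle))

/-- A family of fewer than `𝔭` subsets of a denumerable set all of whose finite subfamilies have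
infinite intersections has a pseudointersection. -/
theorem exists_infinite_forall_diff_finite {I : Type} {D : Type*} [Denumerable D]
    (hI : #I < pseudointersectionNumber) (A : I → Set D)
    (hA : ∀ G : Set I, G.Finite → (⋂ i ∈ G, A i).Infinite) :
    ∃ a : Set D, a.Infinite ∧ ∀ i, (a \ A i).Finite := by
  let e := Denumerable.eqv D
  let B : I → Set ℕ := fun i => e.symm ⁻¹' A i
  have hB : IsCenteredFamily (range B) := by
    intro G hG hfin
    obtain ⟨G', hG'fin, rfl⟩ : ∃ G' : Set I, G'.Finite ∧ B '' G' = G := by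
      choose r hr using fun b : G => hG b.2
      have := hfin.to_subtype
      refine ⟨range r, finite_range r, ?_⟩
      rw [← range_comp, show B ∘ r = Subtype.val from funext hr, Subtype.range_coe]
    have : ⋂₀ (B '' G') = e.symm ⁻¹' (⋂ i ∈ G', A i) := by
      simp only [B, sInter_image, preimage_iInter]
    rw [this]
    exact (hA G' hG'fin).preimage (by simp)
  have hlt : #(range B) < pseudointersectionNumber := mk_range_le.trans_lt hI
  have hex : ∃ a, IsPseudointersection a (range B) := by
    by_contra hno
    refine notMem_of_lt_csInf' hlt ⟨range B, ?_, hB, hno, rfl⟩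
    rintro b hb
    simpa using hB {b} (singleton_subset_iff.2 hb) (finite_singleton b)
  obtain ⟨a, ha, hab⟩ := hex
  refine ⟨e.symm '' a, ha.image e.symm.injective.injOn, fun i => ?_⟩
  refine ((hab (B i) (mem_range_self i)).image e.symm).subset ?_
  rintro _ ⟨⟨n, hn, rfl⟩, hni⟩
  exact ⟨n, ⟨hn, hni⟩, rfl⟩

/-- For fewer than `𝔭` functions `f i : ℕ → ℕ` there are a function `g` and a partition of a final
segment of `ℕ` into intervals such that `g` agrees with each `f i` somewhere in almost every
interval. -/
theorem exists_eventually_exists_mem_Ico_eq {I : Type} (hI : #I < pseudointersectionNumber)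
    (f : I → ℕ → ℕ) :
    ∃ g c : ℕ → ℕ, StrictMono c ∧
      ∀ i, ∀ᶠ j in atTop, ∃ m ∈ Ico (c j) (c (j + 1)), g m = f i m := by
  have hp : ℵ₀ < pseudointersectionNumber :=
    aleph0_lt_pseudointersectionNumber (pos_of_gt hI).ne'
  -- A pair `(n, l)` is a block of guessed values on `[n, n + l.length)`. A pseudointersection
  -- supplies blocks arbitrarily far out, almost all of them meeting each `f i`.
  let A : I ⊕ ℕ → Set (ℕ × List ℕ) := Sum.elim
    (fun i => {q | ∃ k < q.2.length, q.2.getD k 0 = f i (q.1 + k)}) (fun n => {q | n ≤ q.1})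
  have hJ : #(I ⊕ ℕ) < pseudointersectionNumber := by
    rw [mk_sum, lift_id, lift_id, mk_nat]
    exact add_lt_of_lt hp.le hI hp
  have hA : ∀ G : Set (I ⊕ ℕ), G.Finite → (⋂ i ∈ G, A i).Infinite := by
    intro G hG
    have hG1 := (hG.preimage (f := Sum.inl) Sum.inl_injective.injOn)
    have hG2 := (hG.preimage (f := Sum.inr) Sum.inr_injective.injOn)
    obtain ⟨N, hN⟩ := hG2.bddAbove
    let l : List I := hG1.toFinset.toList
    -- The block agrees with the `r`-th function of the finite list at its `r`-th position.
    let s : ℕ → ℕ × List ℕ := fun n =>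
      (N + n, List.ofFn fun r : Fin l.length => f l[r] (N + n + r))
    have hs : Function.Injective s := fun a b h => by
      have := congrArg Prod.fst h
      simpa [s] using this
    refine (infinite_range_of_injective hs).mono ?_
    rintro _ ⟨n, rfl⟩
    refine mem_iInter₂.2 ?_
    rintro (i | k) hi
    · have hil : i ∈ l := by simpa [l] using hi
      obtain ⟨r, hr, rfl⟩ := List.mem_iff_getElem.1 hil
      refine ⟨r, by simpa [s] using hr, ?_⟩
      simp [s, hr]
    · exact (hN hi).trans (Nat.le_add_right _ _)
  obtain ⟨P, hP, hPA⟩ := exists_infinite_forall_diff_finite hJ A hA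
  have hbig : ∀ n, ∃ q ∈ P, n ≤ q.1 := by
    intro n
    obtain ⟨q, hq, hn⟩ := (hP.sdiff (hPA (Sum.inr n))).nonempty
    refine ⟨q, hq, ?_⟩
    by_contra h
    exact hn ⟨hq, h⟩
  choose pick hpickP hpick using hbig
  -- Each block starts past the end of the previous one; the `+ 1` keeps the starts strictly
  -- increasing even for empty lists.
  let q : ℕ → ℕ × List ℕ := fun j =>
    Nat.rec (pick 0) (fun _ r => pick (r.1 + r.2.length + 1)) j
  have hqP : ∀ j, q j ∈ P := by
    rintro (_ | j)
    exacts [hpickP _, hpickP _]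
  have hqs : ∀ j, (q j).1 + (q j).2.length + 1 ≤ (q (j + 1)).1 := fun j => hpick _
  let c : ℕ → ℕ := fun j => (q j).1
  have hc : StrictMono c := strictMono_nat_of_lt_succ fun j => by
    have := hqs j
    simp only [c]
    omega
  have hg : ∀ m, ∃ v, ∀ j, m ∈ Ico (c j) (c (j + 1)) → v = (q j).2.getD (m - c j) 0 := by
    intro m
    by_cases h : ∃ j, m ∈ Ico (c j) (c (j + 1))
    · obtain ⟨j, hj⟩ := h
      refine ⟨(q j).2.getD (m - c j) 0, fun j' hj' => ?_⟩
      have : j = j' := by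
        by_contra hne
        exact disjoint_left.1 (hc.monotone.pairwise_disjoint_on_Ico_succ hne) hj hj'
      rw [this]
    · exact ⟨0, fun j hj => (h ⟨j, hj⟩).elim⟩
  choose g hg using hg
  refine ⟨g, c, hc, fun i => ?_⟩
  have hqinj : Function.Injective q := fun a b h => hc.injective (congrArg Prod.fst h)
  have hfin := (hPA (Sum.inl i)).preimage (f := q) hqinj.injOn
  obtain ⟨N, hN⟩ := hfin.bddAbove
  filter_upwards [eventually_gt_atTop N] with j hj
  have hmem : q j ∈ A (Sum.inl i) := by
    by_contra h
    exact absurd (hN (show j ∈ q ⁻¹' _ from ⟨hqP j, h⟩)) (not_le.2 hj)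
  obtain ⟨k, hk, hkf⟩ := hmem
  have hcj : c j + k ∈ Ico (c j) (c (j + 1)) := by
    refine ⟨Nat.le_add_right _ _, ?_⟩
    have := hqs j
    simp only [c]
    omega
  refine ⟨c j + k, hcj, ?_⟩
  rw [hg _ j hcj, Nat.add_sub_cancel_left]
  exact hkf

/-! ### Integer codes for open sets, and intervals of an enumeration -/

/-- The finite unions of products of a cylinder of the Cantor space and a basic open set of a second
countable space `Y`, listed as `E 0, E 1, …`; membership in `E c` depends on the first `k c`
coordinates only. -/
theorem exists_cylindrical_sets (Y : Type*) [TopologicalSpace Y] [SecondCountableTopology Y] :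
    ∃ (E : ℕ → Set ((ℕ → Bool) × Y)) (k : ℕ → ℕ), (∀ c, IsOpen (E c)) ∧
      (∀ c x x' y, (∀ i < k c, x' i = x i) → (x, y) ∈ E c → (x', y) ∈ E c) ∧
      ∀ O, IsOpen O → ∀ F : Set ((ℕ → Bool) × Y), F.Finite → F ⊆ O → ∃ c, F ⊆ E c ∧ E c ⊆ O := by
  classical
  have hB := TopologicalSpace.isBasis_countableBasis Y
  have := (TopologicalSpace.countable_countableBasis Y).to_subtype
  -- The default `false` is never read: the cylinder tests only indices below `l.length`.
  let cyl : List Bool → Set (ℕ → Bool) := fun l => PiNat.cylinder (fun i => l.getD i false) l.length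
  let E : Finset (List Bool × TopologicalSpace.countableBasis Y) → Set ((ℕ → Bool) × Y) :=
    fun C => ⋃ q ∈ C, cyl q.1 ×ˢ (q.2 : Set Y)
  obtain ⟨e, he⟩ := exists_surjective_nat (Finset (List Bool × TopologicalSpace.countableBasis Y))
  refine ⟨fun c => E (e c), fun c => (e c).sup fun q => q.1.length, fun c => ?_, ?_, ?_⟩
  · exact isOpen_biUnion fun q _ => (PiNat.isOpen_cylinder _ _ _).prod (hB.isOpen q.2.2)
  · intro c x x' y hxx' hxy
    obtain ⟨q, hq, hx, hy⟩ := mem_iUnion₂.1 hxy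
    refine mem_iUnion₂.2 ⟨q, hq, fun i hi => ?_, hy⟩
    have : q.1.length ≤ (e c).sup fun q => q.1.length :=
      Finset.le_sup (f := fun q : List Bool × TopologicalSpace.countableBasis Y => q.1.length) hq
    exact (hxx' i (hi.trans_le this)).trans (hx i hi)
  · intro O hO F hF hFO
    have h : ∀ z ∈ F, ∃ q : List Bool × TopologicalSpace.countableBasis Y,
        z ∈ cyl q.1 ×ˢ (q.2 : Set Y) ∧ cyl q.1 ×ˢ (q.2 : Set Y) ⊆ O := by
      rintro ⟨x, y⟩ hz
      obtain ⟨u, v, hu, hv, hxu, hyv, huv⟩ := isOpen_prod_iff.1 hO x y (hFO hz)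
      obtain ⟨_, ⟨x', n, rfl⟩, hx', hxs⟩ :=
        (PiNat.isTopologicalBasis_cylinders fun _ : ℕ => Bool).exists_subset_of_mem_open hxu hu
      obtain ⟨w, hw, hyw, hwv⟩ := hB.exists_subset_of_mem_open hyv hv
      have hcyl : cyl (List.ofFn fun i : Fin n => x' i) = PiNat.cylinder x' n := by
        ext z
        simp only [cyl, PiNat.mem_cylinder_iff, List.length_ofFn]
        refine forall₂_congr fun i hi => ?_
        simp [hi]
      refine ⟨(List.ofFn fun i : Fin n => x' i, ⟨w, hw⟩), ?_, ?_⟩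
      · exact ⟨hcyl ▸ hx', hyw⟩
      · exact (prod_mono (hcyl.trans_subset hxs) hwv).trans huv
    choose q hq hqO using fun z : F => h z z.2
    have := hF.fintype
    obtain ⟨c, hc⟩ := he (Finset.univ.image q)
    refine ⟨c, fun z hz => ?_, ?_⟩
    · refine mem_iUnion₂.2 ⟨q ⟨z, hz⟩, ?_, hq ⟨z, hz⟩⟩
      rw [hc]
      exact Finset.mem_image_of_mem q (Finset.mem_univ _)
    · simp only [hc]
      refine iUnion₂_subset fun p hp => ?_
      obtain ⟨z, -, rfl⟩ := Finset.mem_image.1 hp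
      exact hqO z

theorem enumInterval_range {α : ℕ → ℕ} (hα : StrictMono α) (n : ℕ) :
    enumInterval (range α) n = Ico (α n) (α (n + 1)) := by
  have hinf : ¬ (Set.ofPred (· ∈ range α)).Finite := infinite_range_of_injective hα.injective
  have h : ∀ n, Nat.nth (· ∈ range α) n = α n := fun n => by
    rw [← Nat.nth_comp_of_strictMono hα (fun k hk => hk) fun h => (hinf h).elim]
    simp
  rw [enumInterval, h, h]

/-- The subset of `ℕ` with characteristic function `x`. -/
def boolSupport (x : ℕ → Bool) : Set ℕ := {n | x n = true}

theorem boolSupport_injective : Function.Injective boolSupport := fun x y h => by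
  funext n
  exact Bool.eq_iff_iff.2 (Set.ext_iff.1 h n)

/-! ### One stage of the selection -/

/-- Given `ω`-covers of the product of a `𝔭`-generalized tower set and a space satisfying `γ`, and a
subset `S` of the tower with `|S| < 𝔭`, one can select from them sets that capture all finite sets
avoiding a small part of the tower disjoint from `S`. -/
theorem IsGeneralizedTower.exists_selection {X : Set (Set ℕ)}
    (hX : IsGeneralizedTower pseudointersectionNumber X)
    {Y : Type*} [TopologicalSpace Y] [SecondCountableTopology Y] [T1Space Y] (hY : SatisfiesGamma Y)
    (U : ℕ → Set (Set (towerSet X × Y))) (hU : ∀ n, U n ∈ omegaCovers (towerSet X × Y))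
    {S : Set (Set ℕ)} (hSX : S ⊆ X) (hS : #S < pseudointersectionNumber) :
    ∃ V : ℕ → Set (towerSet X × Y), (∀ n, V n ∈ U n) ∧
      ∃ S' ⊆ X, #S' < pseudointersectionNumber ∧ ∀ F : Set (towerSet X × Y), F.Finite →
        (∀ z ∈ F, boolSupport z.1 ∉ S' \ S) → ∃ n, F ⊆ V n := by
  classical
  have hp : ℵ₀ < pseudointersectionNumber :=
    aleph0_lt_pseudointersectionNumber (pos_of_gt hS).ne'
  obtain ⟨E, k, hE, hk, hEF⟩ := exists_cylindrical_sets Y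
  let ι : towerSet X × Y → (ℕ → Bool) × Y := Prod.map Subtype.val id
  have hι : Topology.IsEmbedding ι := Topology.IsEmbedding.subtypeVal.prodMap .id
  let valid : ℕ → ℕ → Prop := fun n c => ∃ u ∈ U n, ι ⁻¹' E c ⊆ u
  have hvalid : ∀ n, ∀ F : Set ((ℕ → Bool) × Y), F.Finite → (∀ z ∈ F, z.1 ∈ towerSet X) →
      ∃ c, valid n c ∧ F ⊆ E c := by
    intro n F hF hFX
    obtain ⟨u, hu, hFu⟩ := (hU n).2 (ι ⁻¹' F) (hF.preimage hι.injective.injOn)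
    obtain ⟨O, hO, rfl⟩ := hι.isInducing.isOpen_iff.1 ((hU n).1.2 u hu)
    have hFO : F ⊆ O := fun z hz => hFu (show ((⟨z.1, hFX z hz⟩, z.2) : towerSet X × Y) ∈ ι ⁻¹' F
      from hz)
    obtain ⟨c, hFc, hcO⟩ := hEF O hO F hF hFO
    exact ⟨c, ⟨_, hu, preimage_mono hcO⟩, hFc⟩
  let Q : ℕ → Finset S → Set (ℕ → Bool) := fun m G =>
    boolSupport ⁻¹' ({s | s ⊆ Iio m} ∪ Subtype.val '' (G : Set S))
  have hQfin : ∀ m G, (Q m G).Finite := fun m G =>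
    ((finite_Iio m).finite_subsets.union (G.finite_toSet.image _)).preimage
      boolSupport_injective.injOn
  have hQX : ∀ m G, ∀ x ∈ Q m G, x ∈ towerSet X := by
    rintro m G x (hx | ⟨s, -, hs⟩)
    · exact Or.inr ((finite_Iio m).subset hx)
    · exact Or.inl (show boolSupport x ∈ X from hs ▸ hSX s.2)
  have hsel : ∀ G : Finset S, ∃ f : ℕ → ℕ, (∀ m, valid m (f m)) ∧
      ∀ y, ∀ᶠ m in atTop, ∀ x ∈ Q m G, (x, y) ∈ E (f m) := by
    intro G
    let W : ℕ → Set (Set Y) := fun m =>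
      -- The points `y` whose whole fibre over the finite set `Q m G` lies in `E c`; this reduces
      -- the product to `Y`.
      {w | ∃ c, valid m c ∧ w = ⋂ x ∈ Q m G, {y | (x, y) ∈ E c}}
    have hWopen : ∀ m, ∀ w ∈ W m, IsOpen w := by
      rintro m _ ⟨c, -, rfl⟩
      exact (hQfin m G).isOpen_biInter fun x _ => (hE c).preimage (Continuous.prodMk_right x)
    have hWcov : ∀ m, ∀ F : Set Y, F.Finite → ∃ w ∈ W m, F ⊆ w := by
      intro m F hF
      obtain ⟨c, hc, hsub⟩ := hvalid m (Q m G ×ˢ F) ((hQfin m G).prod hF)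
        fun z hz => hQX m G _ hz.1
      exact ⟨_, ⟨c, hc, rfl⟩, fun y hy => mem_iInter₂.2 fun x hx => hsub ⟨hx, hy⟩⟩
    obtain ⟨w, hw, hwy⟩ := hY.exists_selection W hWopen hWcov
    choose f hf hfw using hw
    refine ⟨f, hf, fun y => (hwy y).mono fun m hm x hx => ?_⟩
    rw [hfw m] at hm
    exact mem_iInter₂.1 hm x hx
  choose f hf hfy using hsel
  have hfS : #(Finset S) < pseudointersectionNumber := by
    rcases finite_or_infinite S with h | h
    · exact (lt_aleph0_of_finite _).trans hp
    · rwa [mk_finset_of_infinite]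
  obtain ⟨g, c, hc, hgf⟩ := exists_eventually_exists_mem_Ico_eq hfS f
  -- Merging intervals up to `c j'` makes membership in `E (g m)`, for `m` in the `j`-th interval,
  -- depend only on coordinates below `c j'`.
  have hnext : ∀ j, ∃ j', j < j' ∧ ∀ m ∈ Ico (c j) (c (j + 1)), k (g m) ≤ c j' := by
    intro j
    obtain ⟨N, hN⟩ := ((finite_Ico (c j) (c (j + 1))).image fun m => k (g m)).bddAbove
    refine ⟨N + j + 1, by omega, fun m hm => (hN (mem_image_of_mem _ hm)).trans ?_⟩
    exact le_trans (by omega) (show N + j + 1 ≤ c (N + j + 1) from hc.id_le _)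
  choose next hlt hnext using hnext
  let J : ℕ → ℕ := fun i => next^[i] 0
  have hJs : ∀ i, J (i + 1) = next (J i) := fun i => Function.iterate_succ_apply' _ _ _
  have hJ : StrictMono J := strictMono_nat_of_lt_succ fun i => by
    rw [hJs]
    exact hlt _
  let α : ℕ → ℕ := fun i => c (J i)
  have hα : StrictMono α := hc.comp hJ
  obtain ⟨b, hb, S', hS'X, hS', htower⟩ :=
    hX.2.2 (range α) (infinite_range_of_injective hα.injective)
  simp only [enumInterval_range hα] at htower
  -- Where the guess `g n` is not valid, an arbitrary member of `U n` is taken.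
  have hV : ∀ n, ∃ v ∈ U n, valid n (g n) → ι ⁻¹' E (g n) ⊆ v := by
    intro n
    by_cases h : valid n (g n)
    · obtain ⟨u, hu, hsub⟩ := h
      exact ⟨u, hu, fun _ => hsub⟩
    · obtain ⟨u, hu, -⟩ := (hU n).2 ∅ finite_empty
      exact ⟨u, hu, fun h' => (h h').elim⟩
  choose V hVU hV using hV
  refine ⟨V, hVU, S', hS'X, hS', fun F hF hFS => ?_⟩
  have hGfin : {s : S | ∃ z ∈ F, boolSupport z.1 = s}.Finite := by
    refine Finite.of_finite_image ((hF.image fun z => boolSupport z.1).subset ?_)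
      Subtype.val_injective.injOn
    rintro _ ⟨s, ⟨z, hz, hzs⟩, rfl⟩
    exact ⟨z, hz, hzs⟩
  let G : Finset S := hGfin.toFinset
  obtain ⟨M, hM⟩ := eventually_atTop.1 <|
    (eventually_all_finite hF).2 fun z _ => hfy G z.2
  have hz : ∀ z ∈ F, ∀ᶠ i in atTop, i ∈ b →
      ∀ m ∈ Ico (c (J i)) (c (J i + 1)), g m = f G m → M ≤ m → ι z ∈ E (g m) := by
    intro z hzF
    by_cases hzS : boolSupport z.1 ∈ S
    · refine Eventually.of_forall fun i _ m _ hgm hMm => ?_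
      rw [hgm]
      refine hM m hMm z hzF z.1 (Or.inr ⟨⟨_, hzS⟩, ?_, rfl⟩)
      exact Finset.mem_coe.2 (hGfin.mem_toFinset.2 ⟨z, hzF, rfl⟩)
    · have hfin : (boolSupport z.1 ∩ ⋃ n ∈ b, Ico (α n) (α (n + 1))).Finite := by
        rcases z.1.2 with h | h
        · exact htower _ ⟨h, fun h' => hFS z hzF ⟨h', hzS⟩⟩
        · exact Finite.subset h inter_subset_left
      obtain ⟨N, hN⟩ := hfin.bddAbove
      filter_upwards [eventually_gt_atTop N] with i hi hib m hm hgm hMm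
      have hfalse : ∀ n ∈ Ico (α i) (α (i + 1)), z.1.1 n = false := by
        intro n hn
        by_contra h
        have h1 : n ≤ N := hN ⟨by simpa [boolSupport] using h, mem_iUnion₂.2 ⟨i, hib, hn⟩⟩
        have h2 := hα.id_le i
        have h3 := hn.1
        simp only [id] at h2
        omega
      -- The truncation of `z.1` below `m` is a subset of `[0, m)`, hence lies in `Q m G`. It agrees
      -- with `z.1` below `α (i + 1)`, because `m ≥ α i` and `z.1` vanishes on that interval.
      have hmem : ((fun n => if n < m then z.1.1 n else false), z.2) ∈ E (g m) := by
        rw [hgm]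
        refine hM m hMm z hzF _ (Or.inl fun n hn => ?_)
        by_contra h
        simp only [mem_Iio] at h
        simp [boolSupport, h] at hn
      refine hk (g m) _ z.1.1 z.2 (fun n hn => ?_) hmem
      split_ifs with h
      · rfl
      · refine hfalse n ⟨hm.1.trans (not_lt.1 h), hn.trans_le ?_⟩
        simp only [α, hJs]
        exact hnext _ m hm
  obtain ⟨N, hN⟩ := eventually_atTop.1 ((eventually_all_finite hF).2 hz)
  obtain ⟨K, hK⟩ := eventually_atTop.1 (hgf G)
  obtain ⟨i, hib, hi⟩ := hb.exists_gt (max (max N K) M)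
  have hJi : i ≤ J i := hJ.id_le i
  have hci : J i ≤ c (J i) := hc.id_le _
  have hNi : N ≤ i ∧ K ≤ J i ∧ M ≤ c (J i) := by omega
  obtain ⟨m, hm, hgm⟩ := hK (J i) hNi.2.1
  exact ⟨m, fun z hzF => hV m (hgm ▸ hf G m)
    (hN i hNi.1 z hzF hib m hm hgm (hNi.2.2.trans hm.1))⟩

/-! ### Combining the stages -/

theorem mainTheorem7 (X : Set (Set ℕ)) (hX : IsGeneralizedTower pseudointersectionNumber X)
    (Y : Type*) [TopologicalSpace Y] (hYreal : IsSetOfReals Y) (hY : SatisfiesGamma Y) :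
    SelOne (omegaCovers (towerSet X × Y)) (omegaCovers (towerSet X × Y)) := by
  obtain ⟨R, ⟨e⟩⟩ := hYreal
  have : SecondCountableTopology Y := e.isEmbedding.secondCountableTopology
  have : T1Space Y := e.symm.t1Space
  intro U hU
  let Small := {S : Set (Set ℕ) // S ⊆ X ∧ #S < pseudointersectionNumber}
  have hp0 : (0 : Cardinal) < pseudointersectionNumber := by
    obtain ⟨b, -, S, -, hS, -⟩ := hX.2.2 univ infinite_univ
    exact pos_of_gt hS
  have hp := aleph0_lt_pseudointersectionNumber hp0.ne'
  have hstep : ∀ (k : ℕ) (S : Small), ∃ V : ℕ → Set (towerSet X × Y),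
      (∀ j, V j ∈ U (Nat.pair k j)) ∧ ∃ S' : Small, S.1 ⊆ S'.1 ∧
        ∀ F : Set (towerSet X × Y), F.Finite → (∀ z ∈ F, boolSupport z.1 ∉ S'.1 \ S.1) →
          ∃ j, F ⊆ V j := by
    rintro k ⟨S, hSX, hS⟩
    obtain ⟨V, hV, S', hS'X, hS', h⟩ :=
      hX.exists_selection hY (fun j => U (Nat.pair k j)) (fun j => hU _) hSX hS
    refine ⟨V, hV, ⟨S ∪ S', union_subset hSX hS'X,
      (mk_union_le _ _).trans_lt (add_lt_of_lt hp.le hS hS')⟩, subset_union_left, ?_⟩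
    exact fun F hF hFS => h F hF fun z hz hzS => hFS z hz ⟨Or.inr hzS.1, hzS.2⟩
  choose V hV next hsub hnext using hstep
  let T : ℕ → Small := fun k =>
    Nat.rec ⟨∅, empty_subset _, by rwa [mk_eq_zero]⟩ (fun k S => next k S) k
  have hmono : Monotone fun k => (T k).1 := monotone_nat_of_le_succ fun k => hsub k (T k)
  let v : ℕ → Set (towerSet X × Y) := fun n => V n.unpair.1 (T n.unpair.1) n.unpair.2
  have hv : ∀ n, v n ∈ U n := fun n => by
    simpa only [Nat.pair_unpair] using hV n.unpair.1 (T n.unpair.1) n.unpair.2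
  have hcov : ∀ F : Set (towerSet X × Y), F.Finite → ∃ u ∈ range v, F ⊆ u := by
    intro F hF
    -- Otherwise `F` would have a point over each of the disjoint sets `T (k + 1) \ T k`, hence
    -- infinitely many points.
    obtain ⟨k, hk⟩ : ∃ k, ∀ z ∈ F, boolSupport z.1 ∉ (T (k + 1)).1 \ (T k).1 := by
      by_contra! h
      choose z hzF hz using h
      have hinj : Function.Injective z := by
        have hne : ∀ i j, i < j → z i ≠ z j := fun i j hij h =>
          (hz j).2 (hmono hij (h ▸ (hz i).1))
        intro i j h
        by_contra hij
        rcases lt_or_gt_of_ne hij with hij | hij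
        exacts [hne i j hij h, hne j i hij h.symm]
      exact infinite_range_of_injective hinj (hF.subset (range_subset_iff.2 hzF))
    obtain ⟨j, hj⟩ := hnext k (T k) F hF hk
    refine ⟨_, mem_range_self (Nat.pair k j), ?_⟩
    simpa only [v, Nat.unpair_pair] using hj
  refine ⟨v, hv, ⟨⟨⟨?_, ?_⟩, ?_⟩, hcov⟩⟩
  · rintro _ ⟨n, rfl⟩
    exact (hU n).1.1.1 _ (hv n)
  · refine eq_univ_of_forall fun z => ?_
    obtain ⟨u, hu, hz⟩ := hcov {z} (finite_singleton z)
    exact ⟨u, hu, hz rfl⟩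
  · rintro _ ⟨n, rfl⟩
    exact (hU n).1.2 _ (hv n)
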